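/- **Setting.** Let $V$ be the set of values: the terms freely generated from a set $A$ of atomic values by the composition operations of a signature $L$ (so composition has no collisions). Let $P$ be the set of principals, with one (merged) intruder $o\in P$. A communication rule $(p_b,v,p_a,k_a)\in P\times V\times P\times 2^{P\times V}$ says that $p_b$ tells $v$ to $p_a$ once the state $k_a$ is attained. For a set $R$ of rules, $f_R(k)$ adds to $k\subseteq P\times V$ all $(p_a,v)$ with $(p_b,v,p_a,k_a)\in R$, $(p_b,v)\in k$, $k_a\subseteq k$; $f_R^*(k)=\bigcup_n f_R^n(k)$; $Knowledge(k)=\{v:\exists p\,(p,v)\in k\}$; a state is valid for $(R,k_0)$ if it is $f^*_{R'}(\kappa)$ with $R'\subseteq R$, $\kappa\subseteq k_0$. $R(k)$ is the set of rules in $R$ whose value, and whose required values of the learner, lie in $Knowledge(k)$. $g_{R,k}(Y)$ adds to $Y\subseteq V$ every $x$ for which there are $p\ne o$ and $(p,x,o,k_a)\in R(k)$ with $\{v:(o,v)\in k_a\}\subseteq Y$; $g^*_{R,k}(Y)=\bigcup_n g^n_{R,k}(Y)$. *Primitives.* The intruder may use only a given set of composing primitives (from $u_1,\dots,u_n$ obtain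 $f(u_1,\dots,u_n)$) and decomposing primitives (from $f(u_1,\dots,u_n)$ and certain of the components $u_j$ obtain a component $u_i$); each may require some components to be atomic values from a prescribed set. *Sessions.* A protocol is described by parameters, each of which ranges over all of $V$ or over a given set of atomic values; by finitely many rules, each consisting of a finite set of received message templates and one sent message template (terms over $A$ and the parameters); and by a finite set of secret templates. A parameter ranging over all of $V$ that occurs in the sent template of a rule occurs in one of the received templates of that rule. A session is an assignment $\sigma$ of admissible values to the parameters; it contributes the rules "if $o$ knows all received messages, an honest principal tells the sent message to $o$". Let $m$ be the number of distinct subterms of all message and secret templates. *Flow.* $R$ consists of arbitrary rules whose learner is not $o$, the rules of the primitives, and the rules of all sessions; $R_\tau\subseteq R$ is obtained by admitting only the sessions $\tau_1,\dots,\tau_w$. In $k_0$ every principal other than $o$ knows all values, and $o$ knows only atomic values. An attack with $w$ parallel sessions from a state $k$ is a list of sessions $\tau=(\tau_1,\dots,\tau_w)$ such that, for some $i$, $o$ knows in $f^*_{R_\tau}(k)$ all the secrets of the session $\tau_i$. **Theorem.** Let $w\ge 0$. 1. If there is an attack with $w$ parallel sessions from $k_0$, then there are $k_\sigma\subseteq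 k_0$ with $|Knowledge(k_\sigma)|\le wm$ and an attack $\tau$ with $w$ parallel sessions from $k_\sigma$, all of whose session values (instances under the $\tau_i$ of the subterms counted by $m$) lie in $Knowledge(k_\sigma)$; the state $f^*_{R_\tau}(k_\sigma)$ in which it takes place is valid for $(R,k_0)$. 2. There is an attack with $w$ parallel sessions from $k_0$ if and only if there are sessions $\tau=(\tau_1,\dots,\tau_w)$ and $k_\sigma, X_\sigma$ with $\{o\}\times X_\sigma\subseteq k_\sigma\subseteq k_0$ and $|Knowledge(k_\sigma)|\le wm$ such that $g^*_{R_\tau,k_\sigma}(X_\sigma)$ contains all the secrets of some $\tau_i$. Here it is enough to consider $k_\sigma=k_0\cap(P\times W)$ and $X_\sigma=\{v:(o,v)\in k_\sigma\}$ for sets $W$ of at most $wm$ values that are closed under subterms and contain all values of the sessions $\tau_i$. 3. With all rules $R$: if there is an attack with $w$ parallel sessions from $k_0$, then, for some $k_\sigma,X_\sigma$ with $\{o\}\times X_\sigma\subseteq k_\sigma\subseteq k_0$ and $|Knowledge(k_\sigma)|\le wm$, the set $g^*_{R,k_\sigma}(X_\sigma)$ contains all the secrets of some session; and whenever such a set contains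 all the secrets of some session, there is an attack from $k_0$ with some finite number of parallel sessions. 4. For all $R'\subseteq R$ and all $k_\sigma,X_\sigma$ as above, $g^*_{R',k_\sigma}(X_\sigma)=g^{wm}_{R',k_\sigma}(X_\sigma)$. If $A$ and $L$ are finite, there are only finitely many sets $W$ as in part 2. If the intruder's initial knowledge, the sets of atomic values over which parameters range, and the set of composing primitives are finite, then there are only finitely many different sets $g^*_{R',k_\sigma}(X_\sigma)$ with $R'\subseteq R$ and $k_\sigma,X_\sigma$ as above. -/

import Mathlib

/-! Knowledge flows, intruder primitives and protocol sessions. -/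

namespace KnowledgeFlow

/-! ### Knowledge flows over arbitrary principals `P` and values `V` -/

section Flow

variable {P V : Type*}

/-- A communication rule `(p_b, v, p_a, k_a)`: the principal `teller` tells `value` to `learner`
provided that the state of knowledge `needs` has been attained. -/
structure CommRule (P V : Type*) where
  teller : P
  value : V
  learner : P
  needs : Set (P × V)

/-- The values known to at least one principal in the state `k`. -/
def Knowledge (k : Set (P × V)) : Set V := {v | ∃ p, (p, v) ∈ k}

/-- One step `f_R` of the knowledge flow. -/
def fStep (R : Set (CommRule P V)) (k : Set (P × V)) : Set (P × V) :=
  k ∪ {q | ∃ r ∈ R, (r.teller, r.value) ∈ k ∧ r.needs ⊆ k ∧ q = (r.learner, r.value)}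

/-- The maximal state of knowledge `f*_R(k)`, the limit of the increasing sequence `f_R^n(k)`. -/
def fStar (R : Set (CommRule P V)) (k : Set (P × V)) : Set (P × V) :=
  ⋃ n : ℕ, (fStep R)^[n] k

/-- `k` is a valid state of knowledge for the knowledge flow `(R, k₀)`. -/
def IsValidState (R : Set (CommRule P V)) (k₀ k : Set (P × V)) : Prop :=
  ∃ R' ⊆ R, ∃ κ ⊆ k₀, k = fStar R' κ

/-- The rules `R(k)` of `R` that are applicable to the state `k`. -/
def applicable (R : Set (CommRule P V)) (k : Set (P × V)) : Set (CommRule P V) :=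
  {r | r ∈ R ∧ insert r.value {v | (r.learner, v) ∈ r.needs} ⊆ Knowledge k}

/-- The relation `Y → x` of the flow, seen by the intruder `o`: some principal other than `o`
tells `x` to `o` as soon as `o` knows exactly the required values `Y`. -/
def Arrow (R : Set (CommRule P V)) (o : P) (k : Set (P × V)) (Y : Set V) (x : V) : Prop :=
  ∃ r ∈ applicable R k, r.teller ≠ o ∧ r.learner = o ∧ r.value = x ∧ Y = {v | (o, v) ∈ r.needs}

/-- One step `g_{R,k}` of the intruder's flow of values. -/
def gStep (R : Set (CommRule P V)) (o : P) (k : Set (P × V)) (Y : Set V) : Set V :=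
  Y ∪ {x | ∃ Z ⊆ Y, Arrow R o k Z x}

/-- The values `g*_{R,k}(Y)` reachable from `Y`, the limit of `g_{R,k}^n(Y)`. -/
def gStar (R : Set (CommRule P V)) (o : P) (k : Set (P × V)) (Y : Set V) : Set V :=
  ⋃ n : ℕ, (gStep R o k)^[n] Y

/-- The pairs `(k_σ, X_σ)` with `{o} × X_σ ⊆ k_σ ⊆ k₀` and `|Knowledge(k_σ)| ≤ N`. -/
def smallStates (o : P) (k₀ : Set (P × V)) (N : ℕ) : Set (Set (P × V) × Set V) :=
  {q | {o} ×ˢ q.2 ⊆ q.1 ∧ q.1 ⊆ k₀ ∧ (Knowledge q.1).encard ≤ N}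

/-- The sets `g*_{R,k_σ}(X_σ)` for the small pairs `(k_σ, X_σ)`. -/
def checkedSets (R : Set (CommRule P V)) (o : P) (k₀ : Set (P × V)) (N : ℕ) : Set (Set V) :=
  {S | ∃ q ∈ smallStates o k₀ N, S = gStar R o q.1 q.2}

end Flow

/-! ### Values, message templates and sorts

Values are the terms that are freely built from the atomic values `A` by the composition operations
of the signature `L`; freeness says that composition has no collisions. Templates are terms over
the atomic values and the parameters `X` of a session. -/

section Terms

variable {L : FirstOrder.Language} {A X : Type*}

/-- `Subterm s t`: `s` is a (not necessarily proper) subterm of `t`. -/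
inductive Subterm {α : Type*} : L.Term α → L.Term α → Prop
  | refl (t : L.Term α) : Subterm t t
  | arg {n : ℕ} (f : L.Functions n) (ts : Fin n → L.Term α) (i : Fin n) {s : L.Term α} :
      Subterm s (ts i) → Subterm s (FirstOrder.Language.Term.func f ts)

/-- The value obtained from a template by assigning values to the parameters. -/
def inst (σ : X → L.Term A) (t : L.Term (A ⊕ X)) : L.Term A :=
  t.subst (Sum.elim FirstOrder.Language.Term.var σ)

/-- Sorts: `none` is the sort of all values, `some S` the sort of the atomic values in `S`. -/
def OfSort : Option (Set A) → L.Term A → Prop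
  | none, _ => True
  | some S, v => ∃ a ∈ S, v = FirstOrder.Language.Term.var a

end Terms

/-! ### The intruder's primitives -/

section Primitives

variable {L : FirstOrder.Language} {A P : Type*} {o : P}

/-- A composing primitive, a principal different from the intruder `o`: it turns the inputs
`u₁, …, uₙ` into the composite value `fn(u₁, …, uₙ)`. The i-th input may be required to be one of
certain atomic values (such as those owned by the intruder). -/
structure Composer (L : FirstOrder.Language) (A : Type*) {P : Type*} (o : P) where
  arity : ℕ
  fn : L.Functions arity
  sort : Fin arity → Option (Set A)
  principal : {p : P // p ≠ o}

/-- A decomposing primitive: given the composite value `fn(u₁, …, uₙ)` and its components `uᵢ`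
with `i ∈ keys` (such as the key of a ciphertext), it returns the component `u_out`. -/
structure Decomposer (L : FirstOrder.Language) (A : Type*) {P : Type*} (o : P) where
  arity : ℕ
  fn : L.Functions arity
  keys : Set (Fin arity)
  out : Fin arity
  sort : Fin arity → Option (Set A)
  principal : {p : P // p ≠ o}

/-- The communication rules from a composing primitive to the intruder. -/
def Composer.rules (c : Composer L A o) : Set (CommRule P (L.Term A)) :=
  {r | ∃ u : Fin c.arity → L.Term A, (∀ i, OfSort (c.sort i) (u i)) ∧
    r = { teller := c.principal, value := FirstOrder.Language.Term.func c.fn u, learner := o,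
          needs := {o} ×ˢ Set.range u }}

/-- The communication rules from a decomposing primitive to the intruder. -/
def Decomposer.rules (d : Decomposer L A o) : Set (CommRule P (L.Term A)) :=
  {r | ∃ u : Fin d.arity → L.Term A, (∀ i, OfSort (d.sort i) (u i)) ∧
    r = { teller := d.principal, value := u d.out, learner := o,
          needs := {o} ×ˢ insert (FirstOrder.Language.Term.func d.fn u) (u '' d.keys) }}

/-- The primitives available to the intruder: composers and decomposers, and nothing else. -/
structure Primitives (L : FirstOrder.Language) (A : Type*) {P : Type*} (o : P) where
  composers : Set (Composer L A o)
  decomposers : Set (Decomposer L A o)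

def Primitives.rules (prims : Primitives L A o) : Set (CommRule P (L.Term A)) :=
  {r | (∃ c ∈ prims.composers, r ∈ c.rules) ∨ (∃ d ∈ prims.decomposers, r ∈ d.rules)}

end Primitives

/-! ### Protocols and sessions -/

section Protocols

variable {L : FirstOrder.Language} {A X P : Type*} {o : P}

/-- A protocol rule: once the intruder knows (and has delivered) the messages `received`, an honest
principal sends the message `sent`, which the intruder learns. -/
structure ProtocolRule (L : FirstOrder.Language) (A X : Type*) {P : Type*} (o : P) where
  received : Finset (L.Term (A ⊕ X))
  sent : L.Term (A ⊕ X)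
  sender : (X → L.Term A) → {p : P // p ≠ o}

/-- A protocol, given by the parametrized description of one session: the sorts of the parameters,
the finitely many rules, and the values that the intruder must not get to know all together. -/
structure Protocol (L : FirstOrder.Language) (A X : Type*) {P : Type*} (o : P) where
  sort : X → Option (Set A)
  rules : List (ProtocolRule L A X o)
  secrets : Finset (L.Term (A ⊕ X))

namespace Protocol

/-- An assignment of values of the right sorts to the parameters; it determines a session. -/
def IsSession (prot : Protocol L A X o) (σ : X → L.Term A) : Prop :=
  ∀ x, OfSort (prot.sort x) (σ x)

/-- The values used in one session, as described by the protocol: all subterms of the messages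
received or sent and of the secrets. -/
def sessionValues (prot : Protocol L A X o) : Set (L.Term (A ⊕ X)) :=
  {t | (∃ s ∈ prot.secrets, Subterm t s) ∨
    ∃ r ∈ prot.rules, Subterm t r.sent ∨ ∃ u ∈ r.received, Subterm t u}

/-- The number `m` of values used in one session (`sessionValues` is a finite set). -/
noncomputable def size (prot : Protocol L A X o) : ℕ := prot.sessionValues.ncard

/-- A parameter that ranges over all values occurs in a sent message only if it occurs in one of
the messages received before: honest principals do not send arbitrary unspecified values. -/
def RangeRestricted (prot : Protocol L A X o) : Prop :=
  ∀ r ∈ prot.rules, ∀ x, prot.sort x = none →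
    Subterm (FirstOrder.Language.Term.var (Sum.inr x)) r.sent →
    ∃ u ∈ r.received, Subterm (FirstOrder.Language.Term.var (Sum.inr x)) u

/-- The communication rules of the sessions `σ ∈ T`. -/
def sessionRules (prot : Protocol L A X o) (T : Set (X → L.Term A)) :
    Set (CommRule P (L.Term A)) :=
  {c | ∃ σ ∈ T, ∃ r ∈ prot.rules,
    c = { teller := r.sender σ, value := inst σ r.sent, learner := o,
          needs := {o} ×ˢ {v | ∃ u ∈ r.received, v = inst σ u} }}

/-- In the state `k`, the intruder knows all the secrets of the session `σ`. -/
def Breaks (prot : Protocol L A X o) (σ : X → L.Term A) (k : Set (P × L.Term A)) : Prop :=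
  ∀ s ∈ prot.secrets, (o, inst σ s) ∈ k

end Protocol

/-- All communication rules of a flow in which the sessions `σ ∈ T` take place: the rules `H`
between the honest principals, the primitives, and the rules of these sessions. -/
def flowRules (H : Set (CommRule P (L.Term A))) (prims : Primitives L A o)
    (prot : Protocol L A X o) (T : Set (X → L.Term A)) : Set (CommRule P (L.Term A)) :=
  H ∪ prims.rules ∪ prot.sessionRules T

/-- The sets of at most `N` values that are closed under taking subterms. -/
def closedSets (L : FirstOrder.Language) (A : Type*) (N : ℕ) : Set (Set (L.Term A)) :=
  {W | W.encard ≤ N ∧ ∀ t ∈ W, ∀ s, Subterm s t → s ∈ W}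

/-- The part of the state `k` that concerns the values in `W`. -/
def restrictTo (k : Set (P × L.Term A)) (W : Set (L.Term A)) : Set (P × L.Term A) :=
  {q | q ∈ k ∧ q.2 ∈ W}

/-- `τ` is an attack from the state `k` with the `w` parallel sessions `τ 0, …, τ (w - 1)`: using
these sessions, the intruder gets to know all the secrets of one of them. -/
def IsAttack (H : Set (CommRule P (L.Term A))) (prims : Primitives L A o)
    (prot : Protocol L A X o) (k : Set (P × L.Term A)) {w : ℕ} (τ : Fin w → X → L.Term A) : Prop :=
  (∀ i, prot.IsSession (τ i)) ∧
    ∃ i, prot.Breaks (τ i) (fStar (flowRules H prims prot (Set.range τ)) k)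

end Protocols

end KnowledgeFlow

namespace KnowledgeFlow

/-! ### Limits of flows -/

section Flow

variable {P V : Type*}

/-! Honest principals know every value in `k₀`, so a rule whose teller is honest is limited only by
what `o` must already know. What `o` learns is therefore an inductive notion of derivation, `Derives
... K W`, whose parameter `W` bounds the values that may occur. Every value reached by `fStar` or
`gStar` is derivable with `W = Set.univ`. Conversely, a derivation inside `W` can be replayed by
both flows from the restriction of `k₀` to `W`. The theorem thus reduces to finding an attack
derivation inside a small `W`.

Two ideas give such a `W`. Locality (`Derives.restrict`): initial values are atomic and composition
is free, so decomposing a value that was just composed gains nothing. Hence a derivable value of `W`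
has a derivation inside `W`, if `W` is closed under subterms and contains the session values.

Minimality (`exists_attack_subterm_closed`): the session values of an attack of least total size are
themselves closed under subterms, so `W` may consist of at most `w * m` values. Otherwise some
session value `func g u` has a component `u j` that is not a session value. Then `func g u` arises
only as the value of a parameter, and replacing it everywhere by `u j` gives a smaller attack
(`Derives.replace`).

For the finiteness claims, the iteration of `gStep` stays inside `Knowledge k` and so stops after `w
* m` steps. Each step adds values from a finite set that depends neither on the rules selected nor
on the state. -/

theorem exists_subset_of_finite_of_subset_iUnion {α : Type*} {f : ℕ → Set α} (hf : Monotone f)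
    {s : Set α} (hs : s.Finite) (h : s ⊆ ⋃ n, f n) : ∃ n, s ⊆ f n := by
  induction s, hs using Set.Finite.induction_on with
  | empty => exact ⟨0, Set.empty_subset _⟩
  | @insert a s _ _ ih =>
    obtain ⟨n, hn⟩ := ih ((Set.subset_insert a s).trans h)
    obtain ⟨k, hk⟩ := Set.mem_iUnion.1 (h (Set.mem_insert a s))
    exact ⟨max n k, Set.insert_subset (hf (le_max_right n k) hk)
      (hn.trans (hf (le_max_left n k)))⟩

theorem monotone_iterate_apply {α : Type*} {f : Set α → Set α} (hf : ∀ s, s ⊆ f s) (s : Set α) :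
    Monotone fun n : ℕ => f^[n] s :=
  monotone_nat_of_le_succ fun n => by
    rw [Function.iterate_succ_apply']
    exact hf _

theorem monotone_iterate_fStep (R : Set (CommRule P V)) (k : Set (P × V)) :
    Monotone fun n : ℕ => (fStep R)^[n] k :=
  monotone_iterate_apply (fun _ => Set.subset_union_left) k

theorem monotone_iterate_gStep (R : Set (CommRule P V)) (o : P) (k : Set (P × V)) (Y : Set V) :
    Monotone fun n : ℕ => (gStep R o k)^[n] Y :=
  monotone_iterate_apply (fun _ => Set.subset_union_left) Y

theorem subset_fStar (R : Set (CommRule P V)) (k : Set (P × V)) : k ⊆ fStar R k :=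
  Set.subset_iUnion (fun n : ℕ => (fStep R)^[n] k) 0

theorem subset_gStar (R : Set (CommRule P V)) (o : P) (k : Set (P × V)) (Y : Set V) :
    Y ⊆ gStar R o k Y :=
  Set.subset_iUnion (fun n : ℕ => (gStep R o k)^[n] Y) 0

/-- A finite requirement that is met in the limit is already met at some stage, and the rule fires
at the next one. -/
theorem mem_fStar_of_rule {R : Set (CommRule P V)} {k : Set (P × V)} {r : CommRule P V}
    (hr : r ∈ R) (hteller : (r.teller, r.value) ∈ k) (hfin : r.needs.Finite)
    (hneeds : r.needs ⊆ fStar R k) : (r.learner, r.value) ∈ fStar R k := by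
  obtain ⟨n, hn⟩ := exists_subset_of_finite_of_subset_iUnion (monotone_iterate_fStep R k) hfin
    hneeds
  refine Set.mem_iUnion.2 ⟨n + 1, ?_⟩
  rw [Function.iterate_succ_apply']
  exact Or.inr ⟨r, hr, monotone_iterate_fStep R k (Nat.zero_le n) hteller, hn, rfl⟩

theorem mem_gStar_of_rule {R : Set (CommRule P V)} {o : P} {k : Set (P × V)} {Y : Set V}
    {r : CommRule P V} (hr : r ∈ applicable R k) (hteller : r.teller ≠ o) (hlearner : r.learner = o)
    (hfin : {v | (o, v) ∈ r.needs}.Finite) (hneeds : {v | (o, v) ∈ r.needs} ⊆ gStar R o k Y) :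
    r.value ∈ gStar R o k Y := by
  obtain ⟨n, hn⟩ := exists_subset_of_finite_of_subset_iUnion (monotone_iterate_gStep R o k Y) hfin
    hneeds
  refine Set.mem_iUnion.2 ⟨n + 1, ?_⟩
  rw [Function.iterate_succ_apply']
  exact Or.inr ⟨_, hn, r, hr, hteller, hlearner, rfl, rfl⟩

theorem gStar_subset_of_closed {R : Set (CommRule P V)} {o : P} {k : Set (P × V)} {Y D : Set V}
    (hY : Y ⊆ D)
    (hD : ∀ r ∈ R, r.learner = o → {v | (o, v) ∈ r.needs} ⊆ D → r.value ∈ D) :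
    gStar R o k Y ⊆ D := by
  refine Set.iUnion_subset fun n => ?_
  induction n with
  | zero => exact hY
  | succ n ih =>
    rw [Function.iterate_succ_apply']
    rintro x (hx | ⟨Z, hZ, r, hr, -, hl, rfl, rfl⟩)
    · exact ih hx
    · exact hD r hr.1 hl (hZ.trans ih)

/-- For an upper bound on what `o` learns, the condition on the teller can be dropped. -/
theorem mem_of_mem_fStar_of_closed {R : Set (CommRule P V)} {o : P} {k : Set (P × V)} {D : Set V}
    (hk : ∀ v, (o, v) ∈ k → v ∈ D)
    (hD : ∀ r ∈ R, r.learner = o → {v | (o, v) ∈ r.needs} ⊆ D → r.value ∈ D) {v : V}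
    (hv : (o, v) ∈ fStar R k) : v ∈ D := by
  obtain ⟨n, hn⟩ := Set.mem_iUnion.1 hv
  clear hv
  induction n generalizing v with
  | zero => exact hk v hn
  | succ n ih =>
    rw [Function.iterate_succ_apply'] at hn
    obtain hn | ⟨r, hr, -, hneeds, heq⟩ := hn
    · exact ih hn
    · obtain ⟨rfl, rfl⟩ := Prod.mk.inj heq
      exact hD r hr rfl fun u hu => ih (hneeds hu)

theorem gStep_mono {R R' : Set (CommRule P V)} (h : R ⊆ R') (o : P) (k : Set (P × V))
    {Y Y' : Set V} (hY : Y ⊆ Y') : gStep R o k Y ⊆ gStep R' o k Y' :=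
  Set.union_subset_union hY fun _ ⟨Z, hZ, r, hr, hrest⟩ =>
    ⟨Z, hZ.trans hY, r, ⟨h hr.1, hr.2⟩, hrest⟩

theorem gStar_mono {R R' : Set (CommRule P V)} (h : R ⊆ R') (o : P) (k : Set (P × V))
    (Y : Set V) : gStar R o k Y ⊆ gStar R' o k Y := by
  refine Set.iUnion_mono fun n => ?_
  induction n with
  | zero => exact subset_rfl
  | succ n ih =>
    rw [Function.iterate_succ_apply', Function.iterate_succ_apply']
    exact gStep_mono h o k ih

theorem iterate_gStep_subset_knowledge (R : Set (CommRule P V)) {o : P} {k : Set (P × V)}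
    {Y : Set V} (hY : {o} ×ˢ Y ⊆ k) (n : ℕ) : (gStep R o k)^[n] Y ⊆ Knowledge k := by
  induction n with
  | zero => exact fun v hv => ⟨o, hY ⟨rfl, hv⟩⟩
  | succ n ih =>
    rw [Function.iterate_succ_apply']
    rintro x (hx | ⟨Z, -, r, hr, -, -, rfl, -⟩)
    · exact ih hx
    · exact hr.2 (Set.mem_insert _ _)

/-- An increasing iteration inside a set with at most `N` elements is constant after `N` steps. -/
theorem iterate_fixed_of_encard_le {α : Type*} {f : Set α → Set α} (hf : ∀ s, s ⊆ f s)
    {s B : Set α} {N : ℕ} (hB : B.encard ≤ N) (hs : ∀ n : ℕ, f^[n] s ⊆ B) :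
    f (f^[N] s) = f^[N] s := by
  by_contra hne
  -- Two equal consecutive stages would freeze the iteration, contrary to growth at stage `N`. So
  -- the stages up to `N + 1` grow strictly, and the last has more than `N` elements.
  have hlt : ∀ n ≤ N, f^[n] s ≠ f^[n + 1] s := by
    intro n hn heq
    refine hne ?_
    obtain ⟨d, rfl⟩ := Nat.exists_eq_add_of_le hn
    rw [Function.iterate_succ_apply'] at heq
    have : f^[n + d] s = f^[n] s := by
      rw [add_comm, Function.iterate_add_apply]
      exact Function.iterate_fixed heq.symm d
    rw [this, ← heq]
  have hBfin : B.Finite := Set.finite_of_encard_le_coe hB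
  have hcard : ∀ n ≤ N + 1, n ≤ (f^[n] s).ncard := by
    intro n
    induction n with
    | zero => simp
    | succ n ih =>
      intro hn
      have hss : f^[n] s ⊂ f^[n + 1] s :=
        (monotone_iterate_apply hf s n.le_succ).lt_of_ne (hlt n (by omega))
      have := Set.ncard_lt_ncard hss (hBfin.subset (hs (n + 1)))
      have := ih (by omega)
      omega
  have h1 := hcard (N + 1) le_rfl
  have h2 := Set.ncard_le_ncard (hs (N + 1)) hBfin
  have h3 : B.ncard ≤ N := by
    rw [← hBfin.cast_ncard_eq] at hB
    exact_mod_cast hB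
  omega

theorem gStar_eq_iterate (R : Set (CommRule P V)) {o : P} {k₀ : Set (P × V)} {N : ℕ}
    {q : Set (P × V) × Set V} (hq : q ∈ smallStates o k₀ N) :
    gStar R o q.1 q.2 = (gStep R o q.1)^[N] q.2 := by
  refine Set.Subset.antisymm (Set.iUnion_subset fun n => ?_)
    (Set.subset_iUnion (fun n : ℕ => (gStep R o q.1)^[n] q.2) N)
  have hfix := iterate_fixed_of_encard_le (f := gStep R o q.1) (s := q.2)
    (fun _ => Set.subset_union_left) hq.2.2 (iterate_gStep_subset_knowledge R hq.1)
  refine (monotone_iterate_gStep R o q.1 q.2 (Nat.le_add_left n N)).trans ?_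
  change (gStep R o q.1)^[N + n] q.2 ⊆ _
  rw [add_comm, Function.iterate_add_apply, Function.iterate_fixed hfix]

theorem subset_of_mem_smallStates {o : P} {k₀ : Set (P × V)} {N : ℕ}
    {q : Set (P × V) × Set V} (hq : q ∈ smallStates o k₀ N) : q.2 ⊆ {v | (o, v) ∈ k₀} :=
  fun v hv => hq.2.1 (hq.1 (show (o, v) ∈ {o} ×ˢ q.2 from ⟨rfl, hv⟩))

end Flow

/-! ### Subterms, instances and replacement -/

section Terms

open FirstOrder.Language.Term (var func)

variable {L : FirstOrder.Language} {A X : Type*}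

theorem Subterm.trans {α : Type*} {r s t : L.Term α} (h₁ : Subterm r s) (h₂ : Subterm s t) :
    Subterm r t := by
  induction h₂ with
  | refl => exact h₁
  | arg f ts i _ ih => exact .arg f ts i (ih h₁)

theorem subterm_var_iff {α : Type*} {s : L.Term α} {a : α} : Subterm s (var a) ↔ s = var a :=
  ⟨fun h => by cases h; rfl, fun h => h ▸ .refl _⟩

theorem subterm_func_iff {α : Type*} {n : ℕ} {f : L.Functions n} {ts : Fin n → L.Term α}
    {s : L.Term α} : Subterm s (func f ts) ↔ s = func f ts ∨ ∃ i, Subterm s (ts i) :=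
  ⟨fun h => by
    cases h with
    | refl => exact Or.inl rfl
    | arg _ _ i h => exact Or.inr ⟨i, h⟩,
  fun h => h.elim (fun h => h ▸ .refl _) fun ⟨i, h⟩ => .arg f ts i h⟩

theorem finite_setOf_subterm {α : Type*} (t : L.Term α) : {s | Subterm s t}.Finite := by
  induction t with
  | var a => simp [subterm_var_iff]
  | func f ts ih =>
    refine ((Set.finite_iUnion ih).insert (func f ts)).subset fun s hs => ?_
    obtain rfl | ⟨i, hi⟩ := subterm_func_iff.1 hs
    · exact Set.mem_insert _ _
    · exact Set.mem_insert_of_mem _ (Set.mem_iUnion.2 ⟨i, hi⟩)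

/-- The number of symbols of a term. -/
def termSize {α : Type*} : L.Term α → ℕ
  | var _ => 1
  | func _ ts => 1 + ∑ i, termSize (ts i)

theorem termSize_arg_lt {α : Type*} {n : ℕ} (f : L.Functions n) (ts : Fin n → L.Term α)
    (i : Fin n) : termSize (ts i) < termSize (func f ts) := by
  have := Finset.single_le_sum (f := fun i => termSize (ts i)) (fun _ _ => Nat.zero_le _)
    (Finset.mem_univ i)
  simp only [termSize]
  omega

theorem Subterm.termSize_le {α : Type*} {s t : L.Term α} (h : Subterm s t) :
    termSize s ≤ termSize t := by
  induction h with
  | refl => exact le_rfl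
  | arg f ts i _ ih => exact ih.trans (termSize_arg_lt f ts i).le

theorem not_subterm_arg {α : Type*} {n : ℕ} (f : L.Functions n) (ts : Fin n → L.Term α)
    (i : Fin n) : ¬ Subterm (func f ts) (ts i) := fun h =>
  (termSize_arg_lt f ts i).not_ge h.termSize_le

theorem subterm_closed_of_arg {W : Set (L.Term A)}
    (h : ∀ (n : ℕ) (f : L.Functions n) (ts : Fin n → L.Term A), func f ts ∈ W → ∀ i, ts i ∈ W) :
    ∀ t ∈ W, ∀ s, Subterm s t → s ∈ W := by
  intro t ht s hs
  induction hs with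
  | refl => exact ht
  | arg f ts i _ ih => exact ih (h _ f ts ht i)

@[simp] theorem inst_func (σ : X → L.Term A) {n : ℕ} (f : L.Functions n)
    (ts : Fin n → L.Term (A ⊕ X)) : inst σ (func f ts) = func f fun i => inst σ (ts i) := rfl

theorem inst_subterm_inst (σ : X → L.Term A) {s t : L.Term (A ⊕ X)} (h : Subterm s t) :
    Subterm (inst σ s) (inst σ t) := by
  induction h with
  | refl => exact .refl _
  | arg f ts i _ ih => exact .arg f _ i ih

theorem subterm_inst {σ : X → L.Term A} {t : L.Term (A ⊕ X)} {v : L.Term A}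
    (h : Subterm v (inst σ t)) :
    (∃ s, Subterm s t ∧ inst σ s = v) ∨
      ∃ x, Subterm (var (Sum.inr x)) t ∧ Subterm v (σ x) := by
  induction t with
  | var a =>
    cases a with
    | inl a => exact Or.inl ⟨_, .refl _, (subterm_var_iff.1 h).symm⟩
    | inr x => exact Or.inr ⟨x, .refl _, h⟩
  | func f ts ih =>
    obtain rfl | ⟨i, hi⟩ := subterm_func_iff.1 h
    · exact Or.inl ⟨_, .refl _, rfl⟩
    · exact (ih i hi).imp (fun ⟨s, hs, e⟩ => ⟨s, .arg f ts i hs, e⟩)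
        fun ⟨x, hx, e⟩ => ⟨x, .arg f ts i hx, e⟩

open Classical in
/-- `replace v w t` is `t` with all occurrences of the composite value `v` replaced by `w`. -/
noncomputable def replace (v w : L.Term A) : L.Term A → L.Term A
  | var a => var a
  | func f ts => if func f ts = v then w else func f fun i => replace v w (ts i)

theorem replace_func_of_ne {v w : L.Term A} {n : ℕ} {f : L.Functions n} {ts : Fin n → L.Term A}
    (h : func f ts ≠ v) : replace v w (func f ts) = func f fun i => replace v w (ts i) :=
  if_neg h

@[simp] theorem replace_func_self (w : L.Term A) {n : ℕ} (f : L.Functions n)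
    (ts : Fin n → L.Term A) : replace (func f ts) w (func f ts) = w :=
  if_pos rfl

theorem replace_of_not_subterm {v w t : L.Term A} (h : ¬ Subterm v t) : replace v w t = t := by
  induction t with
  | var a => rfl
  | func f ts ih =>
    rw [subterm_func_iff, not_or, not_exists] at h
    rw [replace_func_of_ne (Ne.symm h.1)]
    congr 1
    exact funext fun i => ih i (h.2 i)

theorem termSize_replace_le {v w : L.Term A} (h : termSize w ≤ termSize v) (t : L.Term A) :
    termSize (replace v w t) ≤ termSize t := by
  induction t with
  | var a => exact le_rfl
  | func f ts ih =>
    by_cases heq : func f ts = v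
    · subst heq
      simpa using h
    · rw [replace_func_of_ne heq]
      exact Nat.add_le_add_left (Finset.sum_le_sum fun i _ => ih i) 1

/-- No composite subterm of the template is instantiated to `v`, so the test in `replace` fails at
every function symbol of the template and the replacement acts only inside parameter values. -/
theorem inst_replace {σ : X → L.Term A} {v w : L.Term A} {t : L.Term (A ⊕ X)}
    (h : ∀ s, Subterm s t → inst σ s = v → ∃ x, s = var (Sum.inr x)) :
    inst (fun x => replace v w (σ x)) t = replace v w (inst σ t) := by
  induction t with
  | var a => cases a <;> rfl
  | func f ts ih =>
    have hne : func f (fun i => inst σ (ts i)) ≠ v := fun heq => by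
      obtain ⟨x, hx⟩ := h _ (.refl _) heq
      cases hx
    rw [inst_func, inst_func, replace_func_of_ne hne]
    congr 1
    exact funext fun i => ih i fun s hs => h s (.arg f ts i hs)

theorem OfSort.replace {S : Option (Set A)} {u : L.Term A} (h : OfSort S u) (v w : L.Term A) :
    OfSort S (replace v w u) := by
  cases S with
  | none => trivial
  | some S =>
    obtain ⟨a, ha, rfl⟩ := h
    exact ⟨a, ha, rfl⟩

/-- The terms of height less than `n` in a finite signature. -/
def boundedTerms (L : FirstOrder.Language) (A : Type*) : ℕ → Set (L.Term A)
  | 0 => ∅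
  | n + 1 => Set.range var ∪
      ⋃ f : Σ n, L.Functions n, func f.2 '' Set.univ.pi fun _ => boundedTerms L A n

theorem finite_boundedTerms [Finite A] [Finite (Σ n, L.Functions n)] (n : ℕ) :
    (boundedTerms L A n).Finite := by
  induction n with
  | zero => exact Set.finite_empty
  | succ n ih =>
    exact (Set.finite_range _).union
      (Set.finite_iUnion fun f => (Set.Finite.pi fun _ => ih).image _)

/-- Each argument of a composite term has strictly fewer subterms than the term itself. -/
theorem mem_boundedTerms {n : ℕ} {t : L.Term A} (h : {s | Subterm s t}.ncard ≤ n) :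
    t ∈ boundedTerms L A n := by
  induction n generalizing t with
  | zero =>
    have := (Set.ncard_eq_zero (finite_setOf_subterm t)).1 (Nat.le_zero.1 h)
    exact absurd (Subterm.refl t) (Set.eq_empty_iff_forall_notMem.1 this t)
  | succ n ih =>
    cases t with
    | var a => exact Or.inl ⟨a, rfl⟩
    | func f ts =>
      refine Or.inr (Set.mem_iUnion.2 ⟨⟨_, f⟩, ts, fun i _ => ih ?_, rfl⟩)
      have hss : {s | Subterm s (ts i)} ⊂ {s | Subterm s (func f ts)} :=
        ⟨fun s hs => .arg f ts i hs, fun hsub => not_subterm_arg f ts i (hsub (.refl (func f ts)))⟩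
      have := Set.ncard_lt_ncard hss (finite_setOf_subterm _)
      omega

theorem finite_closedSets [Finite A] [Finite (Σ n, L.Functions n)] (N : ℕ) :
    (closedSets L A N).Finite := by
  refine (finite_boundedTerms (L := L) (A := A) N).finite_subsets.subset fun W hW t ht => ?_
  have hfin : W.Finite := Set.finite_of_encard_le_coe hW.1
  have hcard : W.ncard ≤ N := by
    have := hW.1
    rw [← hfin.cast_ncard_eq] at this
    exact_mod_cast this
  exact mem_boundedTerms ((Set.ncard_le_ncard (fun s hs => hW.2 t ht s hs) hfin).trans hcard)

end Terms

section Protocols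

open FirstOrder.Language.Term (var func)

variable {L : FirstOrder.Language} {A X P : Type*} {o : P}

/-! ### Session values -/

theorem Protocol.mem_sessionValues_of_subterm {prot : Protocol L A X o} {s t : L.Term (A ⊕ X)}
    (ht : t ∈ prot.sessionValues) (h : Subterm s t) : s ∈ prot.sessionValues := by
  obtain ⟨u, hu, htu⟩ | ⟨r, hr, htr | ⟨u, hu, htu⟩⟩ := ht
  · exact Or.inl ⟨u, hu, h.trans htu⟩
  · exact Or.inr ⟨r, hr, Or.inl (h.trans htr)⟩
  · exact Or.inr ⟨r, hr, Or.inr ⟨u, hu, h.trans htu⟩⟩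

theorem Protocol.secret_mem_sessionValues {prot : Protocol L A X o} {s : L.Term (A ⊕ X)}
    (hs : s ∈ prot.secrets) : s ∈ prot.sessionValues :=
  Or.inl ⟨s, hs, .refl s⟩

theorem Protocol.sent_mem_sessionValues {prot : Protocol L A X o} {r : ProtocolRule L A X o}
    (hr : r ∈ prot.rules) : r.sent ∈ prot.sessionValues :=
  Or.inr ⟨r, hr, Or.inl (.refl _)⟩

theorem Protocol.received_mem_sessionValues {prot : Protocol L A X o} {r : ProtocolRule L A X o}
    (hr : r ∈ prot.rules) {u : L.Term (A ⊕ X)} (hu : u ∈ r.received) : u ∈ prot.sessionValues :=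
  Or.inr ⟨r, hr, Or.inr ⟨u, hu, .refl _⟩⟩

theorem Protocol.finite_sessionValues (prot : Protocol L A X o) : prot.sessionValues.Finite := by
  have h₁ : (⋃ s ∈ {s | s ∈ prot.secrets}, {t | Subterm t s}).Finite :=
    prot.secrets.finite_toSet.biUnion fun s _ => finite_setOf_subterm s
  have h₂ : (⋃ r ∈ {r | r ∈ prot.rules},
      ({t | Subterm t r.sent} ∪ ⋃ u ∈ {u | u ∈ r.received}, {t | Subterm t u})).Finite :=
    prot.rules.finite_toSet.biUnion fun r _ => (finite_setOf_subterm _).union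
      (r.received.finite_toSet.biUnion fun u _ => finite_setOf_subterm u)
  refine (h₁.union h₂).subset ?_
  rintro t (⟨s, hs, ht⟩ | ⟨r, hr, ht | ⟨u, hu, ht⟩⟩)
  · exact Or.inl (Set.mem_biUnion hs ht)
  · exact Or.inr (Set.mem_biUnion hr (Or.inl ht))
  · exact Or.inr (Set.mem_biUnion hr (Or.inr (Set.mem_biUnion hu ht)))

/-- The values of the sessions `σ ∈ T`. -/
def Protocol.instances (prot : Protocol L A X o) (T : Set (X → L.Term A)) : Set (L.Term A) :=
  {v | ∃ σ ∈ T, ∃ t ∈ prot.sessionValues, inst σ t = v}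

theorem Protocol.encard_instances_range_le (prot : Protocol L A X o) {w : ℕ}
    (τ : Fin w → X → L.Term A) :
    (prot.instances (Set.range τ)).encard ≤ (w * prot.size : ℕ) := by
  have hfin := prot.finite_sessionValues
  classical
  have hsub : prot.instances (Set.range τ) ⊆
      ((Finset.univ.biUnion fun i => hfin.toFinset.image (inst (τ i)) : Finset (L.Term A)) :
        Set (L.Term A)) := by
    rintro v ⟨_, ⟨i, rfl⟩, t, ht, rfl⟩
    simp only [Finset.coe_biUnion, Finset.coe_image, Set.mem_iUnion]
    exact ⟨i, Finset.mem_univ i, t, by simpa using ht, rfl⟩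
  refine (Set.encard_le_encard hsub).trans ?_
  rw [Set.encard_coe_eq_coe_finsetCard]
  refine Nat.cast_le.2 ((Finset.card_biUnion_le_card_mul _ _ prot.size fun i _ => ?_).trans ?_)
  · refine Finset.card_image_le.trans ?_
    rw [Protocol.size, Set.ncard_eq_toFinset_card _ hfin]
  · simp

/-! ### Derivations of the intruder -/

/-- The values that the intruder derives from the initial values `K`, the primitives and the
sessions `σ ∈ T`, by derivations in which only values in `W` occur. -/
inductive Derives (prims : Primitives L A o) (prot : Protocol L A X o) (T : Set (X → L.Term A))
    (K W : Set (L.Term A)) : L.Term A → Prop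
  | init {v : L.Term A} : v ∈ K → v ∈ W → Derives prims prot T K W v
  | compose {c : Composer L A o} {u : Fin c.arity → L.Term A} : c ∈ prims.composers →
      (∀ i, OfSort (c.sort i) (u i)) → (∀ i, Derives prims prot T K W (u i)) →
      func c.fn u ∈ W → Derives prims prot T K W (func c.fn u)
  | decompose {d : Decomposer L A o} {u : Fin d.arity → L.Term A} : d ∈ prims.decomposers →
      (∀ i, OfSort (d.sort i) (u i)) → Derives prims prot T K W (func d.fn u) →
      (∀ i ∈ d.keys, Derives prims prot T K W (u i)) → u d.out ∈ W →
      Derives prims prot T K W (u d.out)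
  | session {σ : X → L.Term A} {r : ProtocolRule L A X o} : σ ∈ T → r ∈ prot.rules →
      (∀ u ∈ r.received, Derives prims prot T K W (inst σ u)) → inst σ r.sent ∈ W →
      Derives prims prot T K W (inst σ r.sent)

variable {prims : Primitives L A o} {prot : Protocol L A X o} {T T' : Set (X → L.Term A)}
  {K K' W : Set (L.Term A)}

theorem Derives.mem {v : L.Term A} (h : Derives prims prot T K W v) : v ∈ W := by
  cases h <;> assumption

theorem Derives.mono {v : L.Term A} (h : Derives prims prot T K W v) (hT : T ⊆ T')
    (hK : K ⊆ K') : Derives prims prot T' K' W v := by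
  induction h with
  | init hv hW => exact .init (hK hv) hW
  | compose hc hs _ hW ih => exact .compose hc hs ih hW
  | decompose hd hs _ _ hW ih ihk => exact .decompose hd hs ih ihk hW
  | session hσ hr _ hW ih => exact .session (hT hσ) hr ih hW

theorem derives_of_flowRules {H : Set (CommRule P (L.Term A))} (hH : ∀ r ∈ H, r.learner ≠ o)
    {r : CommRule P (L.Term A)} (hr : r ∈ flowRules H prims prot T) (hlearner : r.learner = o)
    (hneeds : {v | (o, v) ∈ r.needs} ⊆ {v | Derives prims prot T K Set.univ v}) :
    Derives prims prot T K Set.univ r.value := by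
  obtain (hr | ⟨c, hc, u, hs, rfl⟩ | ⟨d, hd, u, hs, rfl⟩) | ⟨σ, hσ, r, hr, rfl⟩ := hr
  · exact absurd hlearner (hH r hr)
  · exact .compose hc hs (fun i => hneeds ⟨rfl, i, rfl⟩) trivial
  · exact .decompose hd hs (hneeds ⟨rfl, Or.inl rfl⟩)
      (fun i hi => hneeds ⟨rfl, Or.inr ⟨i, hi, rfl⟩⟩) trivial
  · exact .session hσ hr (fun u hu => hneeds ⟨rfl, u, hu, rfl⟩) trivial

theorem derives_of_mem_fStar {H : Set (CommRule P (L.Term A))} (hH : ∀ r ∈ H, r.learner ≠ o)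
    {k : Set (P × L.Term A)} {v : L.Term A} (hv : (o, v) ∈ fStar (flowRules H prims prot T) k) :
    Derives prims prot T {v | (o, v) ∈ k} Set.univ v :=
  mem_of_mem_fStar_of_closed (D := {v | Derives prims prot T {v | (o, v) ∈ k} Set.univ v})
    (fun _ hv => .init hv trivial) (fun _ hr hl hn => derives_of_flowRules hH hr hl hn) hv

theorem derives_of_mem_gStar {H : Set (CommRule P (L.Term A))} (hH : ∀ r ∈ H, r.learner ≠ o)
    {k : Set (P × L.Term A)} {Y : Set (L.Term A)} (hY : Y ⊆ K) {v : L.Term A}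
    (hv : v ∈ gStar (flowRules H prims prot T) o k Y) : Derives prims prot T K Set.univ v :=
  gStar_subset_of_closed (D := {v | Derives prims prot T K Set.univ v})
    (fun _ hv => .init (hY hv) trivial) (fun _ hr hl hn => derives_of_flowRules hH hr hl hn) hv

/-- Translates derivation steps into communication rules once for both flows: `D` will be the part
of `fStar` known to `o`, or `gStar`. The conclusion `r.needs.Finite` is passed on because limits of
stages are closed only under rules with finite requirements. -/
theorem Derives.mem_of_closed {H : Set (CommRule P (L.Term A))} {D : Set (L.Term A)}
    (hK : ∀ v ∈ K, v ∈ W → v ∈ D)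
    (hD : ∀ r ∈ flowRules H prims prot T, r.teller ≠ o → r.learner = o → r.value ∈ W →
      (∀ q ∈ r.needs, q.1 = o ∧ q.2 ∈ D ∧ q.2 ∈ W) → r.needs.Finite → r.value ∈ D)
    {v : L.Term A} (h : Derives prims prot T K W v) : v ∈ D := by
  induction h with
  | init hv hW => exact hK _ hv hW
  | @compose c u hc hs hu hW ih =>
    refine hD _ (Or.inl (Or.inr (Or.inl ⟨c, hc, u, hs, rfl⟩))) c.principal.2 rfl hW ?_
      ((Set.finite_singleton o).prod (Set.finite_range u))
    rintro ⟨_, _⟩ ⟨hq, i, rfl⟩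
    exact ⟨hq, ih i, (hu i).mem⟩
  | @decompose d u hd hs hu hk hW ih ihk =>
    refine hD _ (Or.inl (Or.inr (Or.inr ⟨d, hd, u, hs, rfl⟩))) d.principal.2 rfl hW ?_
      ((Set.finite_singleton o).prod ((d.keys.toFinite.image u).insert _))
    rintro ⟨p, v⟩ ⟨hq, hv | ⟨i, hi, rfl⟩⟩
    · obtain rfl : v = _ := hv
      exact ⟨hq, ih, hu.mem⟩
    · exact ⟨hq, ihk i hi, (hk i hi).mem⟩
  | @session σ r hσ hr hu hW ih =>
    refine hD _ (Or.inr ⟨σ, hσ, r, hr, rfl⟩) (r.sender σ).2 rfl hW ?_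
      ((Set.finite_singleton o).prod
        ((r.received.finite_toSet.image (inst σ)).subset fun v ⟨u, hu, h⟩ => ⟨u, hu, h.symm⟩))
    rintro ⟨p, v⟩ ⟨hq, u, hu', hv⟩
    obtain rfl : v = _ := hv
    exact ⟨hq, ih u hu', (hu u hu').mem⟩

theorem Derives.mem_fStar (H : Set (CommRule P (L.Term A))) {k : Set (P × L.Term A)}
    (hhonest : ∀ p, p ≠ o → ∀ v, (p, v) ∈ k) {v : L.Term A}
    (h : Derives prims prot T {v | (o, v) ∈ k} W v) :
    (o, v) ∈ fStar (flowRules H prims prot T) (restrictTo k W) := by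
  refine h.mem_of_closed (H := H)
    (D := {v | (o, v) ∈ fStar (flowRules H prims prot T) (restrictTo k W)})
    (fun v hv hW => subset_fStar _ _ ⟨hv, hW⟩) fun r hr ht hl hW hn hfin => ?_
  have := mem_fStar_of_rule hr (k := restrictTo k W) ⟨hhonest _ ht _, hW⟩ hfin
    fun ⟨p, v⟩ hq => by
      obtain ⟨rfl, hv, -⟩ := hn _ hq
      exact hv
  rwa [hl] at this

theorem Derives.mem_gStar (H : Set (CommRule P (L.Term A))) {k : Set (P × L.Term A)}
    (hhonest : ∀ p, p ≠ o → ∀ v, (p, v) ∈ k) {v : L.Term A}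
    (h : Derives prims prot T {v | (o, v) ∈ k} W v) :
    v ∈ gStar (flowRules H prims prot T) o (restrictTo k W)
      {v | (o, v) ∈ restrictTo k W} := by
  refine h.mem_of_closed (H := H)
    (D := gStar (flowRules H prims prot T) o (restrictTo k W) {v | (o, v) ∈ restrictTo k W})
    (fun v hv hW => subset_gStar _ _ _ _ ⟨hv, hW⟩)
    fun r hr ht hl hW hn hfin => ?_
  -- The teller of the rule is honest and knows all of `W`, which makes the rule applicable.
  have hknown : ∀ v ∈ W, v ∈ Knowledge (restrictTo k W) := fun v hv =>
    ⟨_, hhonest _ ht v, hv⟩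
  exact mem_gStar_of_rule
    ⟨hr, Set.insert_subset (hknown _ hW) fun v hv => hknown v (hn _ hv).2.2⟩ ht hl
    (hfin.preimage (Prod.mk_right_injective o).injOn) fun v hv => (hn _ hv).2.1

/-! ### Locality -/

/-- The values that the intruder composes from values derived within `W` and initial values. -/
inductive Synthesizes (prims : Primitives L A o) (prot : Protocol L A X o)
    (T : Set (X → L.Term A)) (K W : Set (L.Term A)) : L.Term A → Prop
  | derived {v : L.Term A} : Derives prims prot T K W v → Synthesizes prims prot T K W v
  | init {v : L.Term A} : v ∈ K → Synthesizes prims prot T K W v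
  | compose {c : Composer L A o} {u : Fin c.arity → L.Term A} : c ∈ prims.composers →
      (∀ i, OfSort (c.sort i) (u i)) → (∀ i, Synthesizes prims prot T K W (u i)) →
      Synthesizes prims prot T K W (func c.fn u)

/-- If a composed value lies in `W`, so do its components, and the composition takes place inside
`W`. -/
theorem Synthesizes.derives (hW : ∀ t ∈ W, ∀ s, Subterm s t → s ∈ W) {v : L.Term A}
    (h : Synthesizes prims prot T K W v) (hv : v ∈ W) : Derives prims prot T K W v := by
  induction h with
  | derived h => exact h
  | init h => exact .init h hv
  | compose hc hs _ ih =>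
    exact .compose hc hs (fun i => ih i (hW _ hv _ (.arg _ _ i (.refl _)))) hv

/-- Normalization of derivations: decompositions and session steps can be confined to `W`, with only
compositions on top. A decomposed value is not initial, since initial values are atomic; if it is
derived within `W`, then its components lie in `W` too; if it was composed, the detour is cut. -/
theorem Derives.synthesizes (hK : ∀ v ∈ K, ∃ a, v = var a)
    (hW : ∀ t ∈ W, ∀ s, Subterm s t → s ∈ W) (hT : prot.instances T ⊆ W) {v : L.Term A}
    (h : Derives prims prot T K Set.univ v) : Synthesizes prims prot T K W v := by
  induction h with
  | init hv _ => exact .init hv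
  | compose hc hs _ _ ih => exact .compose hc hs ih
  | @decompose d u hd hs _ _ _ ih ihk =>
    generalize ht : func d.fn u = t at ih
    cases ih with
    | derived h =>
      subst ht
      have harg : ∀ i, u i ∈ W := fun i => hW _ h.mem _ (.arg _ _ i (.refl _))
      exact .derived (.decompose hd hs h (fun i hi => (ihk i hi).derives hW (harg i)) (harg _))
    | init h =>
      obtain ⟨a, rfl⟩ := hK _ h
      cases ht
    | compose hc hs' hu =>
      -- By freeness, the value was composed from the same components, so the extracted one has been
      -- synthesized before.
      injection ht with h₁ h₂ h₃
      obtain ⟨arity, fn, keys, out, sort, principal⟩ := d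
      dsimp only at h₁
      subst h₁
      obtain rfl := eq_of_heq h₃
      exact hu _
  | @session σ r hσ hr _ _ ih =>
    exact .derived (.session hσ hr
      (fun u hu => (ih u hu).derives hW
        (hT ⟨σ, hσ, u, Protocol.received_mem_sessionValues hr hu, rfl⟩))
      (hT ⟨σ, hσ, _, Protocol.sent_mem_sessionValues hr, rfl⟩))

/-- A value in a set that is closed under subterms and contains the values of the sessions is
derivable within this set. -/
theorem Derives.restrict (hK : ∀ v ∈ K, ∃ a, v = var a)
    (hW : ∀ t ∈ W, ∀ s, Subterm s t → s ∈ W) (hT : prot.instances T ⊆ W) {v : L.Term A}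
    (h : Derives prims prot T K Set.univ v) (hv : v ∈ W) : Derives prims prot T K W v :=
  (h.synthesizes hK hW hT).derives hW hv

end Protocols

section Protocols

open FirstOrder.Language.Term (var func)

variable {L : FirstOrder.Language} {A X P : Type*} {o : P}
variable {prims : Primitives L A o} {prot : Protocol L A X o} {T : Set (X → L.Term A)}
  {K W : Set (L.Term A)}

/-! ### Replacing a composite value that is not an instance of a composite template -/

/-- The sessions obtained from the sessions `σ ∈ T` by replacing the value `v` by `w`. -/
def replaceSessions (v w : L.Term A) (T : Set (X → L.Term A)) : Set (X → L.Term A) :=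
  (fun σ x => replace v w (σ x)) '' T

section Replace

variable {n : ℕ} {g : L.Functions n} {u : Fin n → L.Term A}

theorem Protocol.inst_replace_of_mem {σ : X → L.Term A} {v w : L.Term A}
    (hg : ∀ t ∈ prot.sessionValues, inst σ t = v → ∃ x, t = var (Sum.inr x))
    {t : L.Term (A ⊕ X)} (ht : t ∈ prot.sessionValues) :
    inst (fun x => replace v w (σ x)) t = replace v w (inst σ t) :=
  inst_replace fun s hs => hg s (Protocol.mem_sessionValues_of_subterm ht hs)

/-- The occurrence lies inside the value of a parameter. As `func g u` is composite, this parameter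
is not of an atomic sort, so range restriction places it in a received message. -/
theorem Protocol.RangeRestricted.subterm_received (hprot : prot.RangeRestricted)
    {σ : X → L.Term A} (hσ : prot.IsSession σ) {r : ProtocolRule L A X o} (hr : r ∈ prot.rules)
    (hg : ∀ t ∈ prot.sessionValues, inst σ t = func g u → ∃ x, t = var (Sum.inr x))
    (h : Subterm (func g u) (inst σ r.sent)) :
    ∃ t ∈ r.received, Subterm (func g u) (inst σ t) := by
  have : ∃ x, Subterm (var (Sum.inr x)) r.sent ∧ Subterm (func g u) (σ x) := by
    obtain ⟨s, hs, heq⟩ | h := subterm_inst h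
    · obtain ⟨x, rfl⟩ := hg s (Protocol.mem_sessionValues_of_subterm
        (Protocol.sent_mem_sessionValues hr) hs) heq
      exact ⟨x, hs, heq ▸ .refl _⟩
    · exact h
  obtain ⟨x, hx, hsub⟩ := this
  have hsort : prot.sort x = none := by
    have hofsort := hσ x
    cases hS : prot.sort x with
    | none => rfl
    | some S =>
      rw [hS] at hofsort
      obtain ⟨a, -, ha⟩ := hofsort
      rw [ha] at hsub
      cases hsub
  obtain ⟨t, ht, hxt⟩ := hprot r hr x hsort hx
  exact ⟨t, ht, hsub.trans (inst_subterm_inst σ hxt)⟩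

/-- If the intruder cannot compose `func g u` after its replacement by one of its components, then
he never gets to know a value in which it occurs. -/
theorem Derives.not_subterm_and_replace (hprot : prot.RangeRestricted)
    (hK : ∀ v ∈ K, ∃ a, v = var a) (hT : ∀ σ ∈ T, prot.IsSession σ)
    (hg : ∀ σ ∈ T, ∀ t ∈ prot.sessionValues, inst σ t = func g u → ∃ x, t = var (Sum.inr x))
    {w : L.Term A}
    (hu : ¬ ∀ i, Derives prims prot (replaceSessions (func g u) w T) K Set.univ (u i))
    {v : L.Term A} (h : Derives prims prot T K Set.univ v) :
    ¬ Subterm (func g u) v ∧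
      Derives prims prot (replaceSessions (func g u) w T) K Set.univ v := by
  induction h with
  | init hv _ =>
    obtain ⟨a, rfl⟩ := hK _ hv
    exact ⟨fun h => (by cases h), .init hv trivial⟩
  | @compose c u' hc hs _ _ ih =>
    refine ⟨fun h => ?_, .compose hc hs (fun i => (ih i).2) trivial⟩
    obtain heq | ⟨i, hi⟩ := subterm_func_iff.1 h
    · injection heq with h₁ h₂ h₃
      obtain ⟨arity, fn, sort, principal⟩ := c
      dsimp only at h₁
      subst h₁
      obtain rfl := eq_of_heq h₃
      exact hu fun i => (ih i).2
    · exact (ih i).1 hi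
  | @decompose d u' hd hs _ _ _ ih ihk =>
    exact ⟨fun h => ih.1 (.arg _ _ _ h), .decompose hd hs ih.2 (fun i hi => (ihk i hi).2) trivial⟩
  | @session σ r hσ hr _ _ ih =>
    have hsent : ¬ Subterm (func g u) (inst σ r.sent) := fun h => by
      obtain ⟨t, ht, hsub⟩ := hprot.subterm_received (hT σ hσ) hr (hg σ hσ) h
      exact (ih t ht).1 hsub
    refine ⟨hsent, ?_⟩
    have := Derives.session (prims := prims) (prot := prot) (K := K) (W := Set.univ)
      (T := replaceSessions (func g u) w T) ⟨σ, hσ, rfl⟩ hr (fun t ht => by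
        rw [Protocol.inst_replace_of_mem (hg σ hσ) (Protocol.received_mem_sessionValues hr ht),
          replace_of_not_subterm (ih t ht).1]
        exact (ih t ht).2) trivial
    rwa [Protocol.inst_replace_of_mem (hg σ hσ) (Protocol.sent_mem_sessionValues hr),
      replace_of_not_subterm hsent] at this

/-- If all components of `func g u` are derivable after the replacement, every step can be imitated:
composing `func g u` becomes deriving `u j`, and decomposing it becomes deriving the component
directly. If some component is not, `func g u` occurs in no derivable value and the replacement
changes none of them. -/
theorem Derives.replace (hprot : prot.RangeRestricted) (hK : ∀ v ∈ K, ∃ a, v = var a)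
    (hT : ∀ σ ∈ T, prot.IsSession σ)
    (hg : ∀ σ ∈ T, ∀ t ∈ prot.sessionValues, inst σ t = func g u → ∃ x, t = var (Sum.inr x))
    (j : Fin n) {v : L.Term A} (h : Derives prims prot T K Set.univ v) :
    Derives prims prot (replaceSessions (func g u) (u j) T) K Set.univ
      (replace (func g u) (u j) v) := by
  by_cases hu : ∀ i, Derives prims prot (replaceSessions (func g u) (u j) T) K Set.univ (u i)
  · induction h with
    | init hv _ =>
      obtain ⟨a, rfl⟩ := hK _ hv
      exact .init hv trivial
    | @compose c u' hc hs _ _ ih =>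
      by_cases heq : func c.fn u' = func g u
      · rw [heq, replace_func_self]
        exact hu j
      · rw [replace_func_of_ne heq]
        exact .compose hc (fun i => (hs i).replace _ _) ih trivial
    | @decompose d u' hd hs _ _ _ ih ihk =>
      by_cases heq : func d.fn u' = func g u
      · injection heq with h₁ h₂ h₃
        obtain ⟨arity, fn, keys, out, sort, principal⟩ := d
        dsimp only at h₁
        subst h₁
        obtain rfl := eq_of_heq h₃
        -- A component of `func g u` cannot contain `func g u`, so the extracted component is
        -- unchanged.
        rw [replace_of_not_subterm (not_subterm_arg g _ _)]
        exact hu _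
      · rw [replace_func_of_ne heq] at ih
        exact .decompose (u := fun i => KnowledgeFlow.replace (func g u) (u j) (u' i)) hd
          (fun i => (hs i).replace _ _) ih ihk trivial
    | @session σ r hσ hr _ _ ih =>
      rw [← Protocol.inst_replace_of_mem (hg σ hσ) (Protocol.sent_mem_sessionValues hr)]
      refine .session ⟨σ, hσ, rfl⟩ hr (fun t ht => ?_) trivial
      rw [Protocol.inst_replace_of_mem (hg σ hσ) (Protocol.received_mem_sessionValues hr ht)]
      exact ih t ht
  · obtain ⟨hsub, hv⟩ := h.not_subterm_and_replace hprot hK hT hg hu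
    rwa [replace_of_not_subterm hsub]

end Replace

/-- The `j`-th argument of a composite template for `func g u` would make `u j` a session value. -/
theorem Protocol.eq_var_of_inst_eq_func {n : ℕ} {g : L.Functions n} {u : Fin n → L.Term A}
    {j : Fin n} (hj : u j ∉ prot.instances T) {σ : X → L.Term A} (hσ : σ ∈ T)
    {t : L.Term (A ⊕ X)} (ht : t ∈ prot.sessionValues) (h : inst σ t = func g u) :
    ∃ x, t = var (Sum.inr x) := by
  cases t with
  | var a =>
    cases a with
    | inl a => cases h
    | inr x => exact ⟨x, rfl⟩
  | func f ts =>
    rw [inst_func] at h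
    injection h with h₁ h₂ h₃
    subst h₁
    obtain rfl := eq_of_heq h₃
    exact absurd ⟨σ, hσ, ts j,
      Protocol.mem_sessionValues_of_subterm ht (.arg f ts j (.refl _)), rfl⟩ hj

/-- An attack of minimal size uses a set of session values that is closed under subterms. -/
theorem exists_attack_subterm_closed (hprot : prot.RangeRestricted)
    (hK : ∀ v ∈ K, ∃ a, v = var a) {w : ℕ} {τ : Fin w → X → L.Term A}
    (hτ : ∀ i, prot.IsSession (τ i))
    (hattack : ∃ i, ∀ s ∈ prot.secrets,
      Derives prims prot (Set.range τ) K Set.univ (inst (τ i) s)) :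
    ∃ τ : Fin w → X → L.Term A, (∀ i, prot.IsSession (τ i)) ∧
      (∃ i, ∀ s ∈ prot.secrets, Derives prims prot (Set.range τ) K Set.univ (inst (τ i) s)) ∧
      ∀ t ∈ prot.instances (Set.range τ), ∀ s, Subterm s t →
        s ∈ prot.instances (Set.range τ) := by
  have hfin := prot.finite_sessionValues
  -- The measure is the total size of all session values, counted once for each session and
  -- template.
  induction hN : ∑ i, ∑ t ∈ hfin.toFinset, termSize (inst (τ i) t)
    using Nat.strong_induction_on generalizing τ with
  | _ N ih =>
    subst hN
    by_cases hclosed : ∀ (n : ℕ) (f : L.Functions n) (ts : Fin n → L.Term A),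
        func f ts ∈ prot.instances (Set.range τ) → ∀ i, ts i ∈ prot.instances (Set.range τ)
    · exact ⟨τ, hτ, hattack, subterm_closed_of_arg hclosed⟩
    push Not at hclosed
    obtain ⟨n, g, u, ⟨_, ⟨i₀, rfl⟩, t₀, ht₀, heq⟩, j, hj⟩ := hclosed
    have hg : ∀ σ ∈ Set.range τ, ∀ t ∈ prot.sessionValues, inst σ t = func g u →
        ∃ x, t = var (Sum.inr x) := fun σ hσ t ht h =>
      Protocol.eq_var_of_inst_eq_func hj hσ ht h
    have hrange : Set.range (fun i x => replace (func g u) (u j) (τ i x)) =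
        replaceSessions (func g u) (u j) (Set.range τ) :=
      Set.range_comp (fun σ x => replace (func g u) (u j) (σ x)) τ
    have hinst : ∀ i, ∀ t ∈ prot.sessionValues,
        inst (fun x => replace (func g u) (u j) (τ i x)) t =
          replace (func g u) (u j) (inst (τ i) t) := fun i t ht =>
      Protocol.inst_replace_of_mem (hg _ ⟨i, rfl⟩) ht
    have hlt := termSize_arg_lt g u j
    have hle : ∀ i, ∀ t ∈ hfin.toFinset,
        termSize (inst (fun x => replace (func g u) (u j) (τ i x)) t) ≤
          termSize (inst (τ i) t) := fun i t ht => by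
      rw [hinst i t (hfin.mem_toFinset.1 ht)]
      exact termSize_replace_le hlt.le _
    refine ih _ ?_ (τ := fun i x => replace (func g u) (u j) (τ i x))
      (fun i x => (hτ i x).replace _ _) ?_ rfl
    · refine Finset.sum_lt_sum (fun i _ => Finset.sum_le_sum (hle i))
        ⟨i₀, Finset.mem_univ _, Finset.sum_lt_sum (hle i₀) ⟨t₀, hfin.mem_toFinset.2 ht₀, ?_⟩⟩
      rw [hinst i₀ t₀ ht₀, heq, replace_func_self]
      exact hlt
    · obtain ⟨i, hi⟩ := hattack
      refine ⟨i, fun s hs => ?_⟩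
      rw [hrange, hinst i s (Protocol.secret_mem_sessionValues hs)]
      exact (hi s hs).replace hprot hK (by rintro _ ⟨i, rfl⟩; exact hτ i) hg j

theorem Derives.mem_of_forall_eq (ho : ∀ p : P, p = o) {v : L.Term A}
    (h : Derives prims prot T K W v) : v ∈ K := by
  cases h with
  | init hv _ => exact hv
  | @compose c => exact absurd (ho _) c.principal.2
  | @decompose d => exact absurd (ho _) d.principal.2
  | @session σ r => exact absurd (ho _) (r.sender σ).2

/-- An attack can be chosen such that the values of its sessions are closed under subterms, known
to some principal, and sufficient to derive the secrets of a session. -/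
theorem exists_local_attack (hprot : prot.RangeRestricted)
    {H : Set (CommRule P (L.Term A))} (hH : ∀ r ∈ H, r.learner ≠ o) {k₀ : Set (P × L.Term A)}
    (hhonest : ∀ p, p ≠ o → ∀ v, (p, v) ∈ k₀)
    (hatomic : ∀ v, (o, v) ∈ k₀ → ∃ a, v = var a) {w : ℕ}
    (h : ∃ τ : Fin w → X → L.Term A, IsAttack H prims prot k₀ τ) :
    ∃ τ : Fin w → X → L.Term A, (∀ i, prot.IsSession (τ i)) ∧
      (∀ t ∈ prot.instances (Set.range τ), ∀ s, Subterm s t →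
        s ∈ prot.instances (Set.range τ)) ∧
      (∀ v ∈ prot.instances (Set.range τ), v ∈ Knowledge k₀) ∧
      ∃ i, ∀ s ∈ prot.secrets,
        Derives prims prot (Set.range τ) {v | (o, v) ∈ k₀} (prot.instances (Set.range τ))
          (inst (τ i) s) := by
  obtain ⟨τ, hτ, hattack⟩ := h
  replace hattack := hattack.imp fun _ hi s hs => derives_of_mem_fStar hH (hi s hs)
  -- Without honest principals there are neither primitives nor protocol rules, and values unknown
  -- to `o` are known to nobody. The broken session then has only initial atomic values, and all `w`
  -- sessions are taken equal to it, since the others may use unknown values.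
  by_cases ho : ∀ p : P, p = o
  · obtain ⟨i, hi⟩ := hattack
    have hmem : ∀ v ∈ prot.instances (Set.range fun _ : Fin w => τ i), (o, v) ∈ k₀ := by
      rintro _ ⟨_, ⟨-, rfl⟩, t, ⟨s, hs, hts⟩ | ⟨r, -, -⟩, rfl⟩
      · have hsk := (hi s hs).mem_of_forall_eq ho
        obtain ⟨a, ha⟩ := hatomic _ hsk
        cases hts with
        | refl => exact hsk
        | arg f ts => cases ha
      · exact absurd (ho _) (r.sender (τ i)).2
    refine ⟨fun _ => τ i, fun _ => hτ i, fun t ht s hs => ?_, fun v hv => ⟨o, hmem v hv⟩, i,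
      fun s hs => ?_⟩
    · obtain ⟨a, rfl⟩ := hatomic _ (hmem t ht)
      rwa [subterm_var_iff.1 hs]
    · have : inst (τ i) s ∈ prot.instances (Set.range fun _ : Fin w => τ i) :=
        ⟨_, ⟨i, rfl⟩, s, Protocol.secret_mem_sessionValues hs, rfl⟩
      exact .init (hmem _ this) this
  · push Not at ho
    obtain ⟨p, hp⟩ := ho
    obtain ⟨τ, hτ, ⟨i, hi⟩, hclosed⟩ := exists_attack_subterm_closed hprot hatomic hτ hattack
    exact ⟨τ, hτ, hclosed, fun v _ => ⟨p, hhonest p hp v⟩, i, fun s hs =>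
      (hi s hs).restrict hatomic hclosed subset_rfl
        ⟨_, ⟨i, rfl⟩, s, Protocol.secret_mem_sessionValues hs, rfl⟩⟩

/-! ### Finiteness -/

/-- Every derivation step has finitely many premises, so the sessions used in a derivation form a
finite union of finite sets. -/
theorem Derives.exists_finite {v : L.Term A} (h : Derives prims prot T K W v) :
    ∃ F ⊆ T, F.Finite ∧ Derives prims prot F K W v := by
  induction h with
  | init hv hW => exact ⟨∅, Set.empty_subset _, Set.finite_empty, .init hv hW⟩
  | compose hc hs _ hW ih =>
    choose F hFT hF hd using ih
    exact ⟨⋃ i, F i, Set.iUnion_subset hFT, Set.finite_iUnion hF, .compose hc hs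
      (fun i => (hd i).mono (Set.subset_iUnion F i) subset_rfl) hW⟩
  | @decompose d u hd hs _ _ hW ih ihk =>
    obtain ⟨F, hFT, hF, hder⟩ := ih
    choose G hGT hG hderk using ihk
    refine ⟨F ∪ ⋃ i, ⋃ hi, G i hi, Set.union_subset hFT (Set.iUnion₂_subset hGT),
      hF.union (Set.finite_iUnion fun i => Set.finite_iUnion (hG i)), .decompose hd hs
      (hder.mono Set.subset_union_left subset_rfl) (fun i hi => (hderk i hi).mono ?_ subset_rfl)
      hW⟩
    exact (Set.subset_iUnion₂ (s := G) i hi).trans Set.subset_union_right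
  | @session σ r hσ hr _ hW ih =>
    choose F hFT hF hd using ih
    refine ⟨insert σ (⋃ u, ⋃ hu, F u hu),
      Set.insert_subset hσ (Set.iUnion₂_subset hFT),
      (r.received.finite_toSet.biUnion' hF).insert σ,
      .session (Set.mem_insert _ _) hr (fun u hu => (hd u hu).mono ?_ subset_rfl) hW⟩
    exact (Set.subset_iUnion₂ (s := F) u hu).trans (Set.subset_insert _ _)

theorem finite_setOf_inst {B : X → Set (L.Term A)} (t : L.Term (A ⊕ X))
    (hB : ∀ x, Subterm (var (Sum.inr x)) t → (B x).Finite) :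
    {v | ∃ σ : X → L.Term A, (∀ x, Subterm (var (Sum.inr x)) t → σ x ∈ B x) ∧
      inst σ t = v}.Finite := by
  induction t with
  | var a =>
    cases a with
    | inl a =>
      refine (Set.finite_singleton (var a : L.Term A)).subset ?_
      rintro _ ⟨σ, -, rfl⟩
      rfl
    | inr x =>
      refine (hB x (.refl _)).subset ?_
      rintro _ ⟨σ, h, rfl⟩
      exact h x (.refl _)
  | func f ts ih =>
    refine ((Set.Finite.pi fun i => ih i fun x hx => hB x (.arg f ts i hx)).image
      (func f)).subset ?_
    rintro _ ⟨σ, h, rfl⟩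
    exact ⟨fun i => inst σ (ts i), fun i _ => ⟨σ, fun x hx => h x (.arg f ts i hx), rfl⟩, rfl⟩

/-- Composers are finite in number and have finitely many inputs from `Y`; decomposers, however
many, return subterms of `Y`; a sent message is determined by its parameters, which range over
finite sets of atoms or, by range restriction, over subterms of `Y`. -/
theorem finite_values_of_flowRules (hprot : prot.RangeRestricted)
    {H : Set (CommRule P (L.Term A))} (hH : ∀ r ∈ H, r.learner ≠ o)
    (hsort : ∀ x S, prot.sort x = some S → S.Finite) (hcomp : prims.composers.Finite)
    {Y : Set (L.Term A)} (hY : Y.Finite) :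
    {x | ∃ r ∈ flowRules H prims prot {σ | prot.IsSession σ}, r.learner = o ∧
      {v | (o, v) ∈ r.needs} ⊆ Y ∧ r.value = x}.Finite := by
  have hsub : (⋃ y ∈ Y, {s | Subterm s y}).Finite :=
    hY.biUnion fun y _ => finite_setOf_subterm y
  let B : X → Set (L.Term A) := fun x =>
    {v | OfSort (prot.sort x) v ∧ (prot.sort x = none → v ∈ ⋃ y ∈ Y, {s | Subterm s y})}
  have hB : ∀ x, (B x).Finite := fun x => by
    cases hx : prot.sort x with
    | none => exact hsub.subset fun v hv => hv.2 hx
    | some S =>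
      refine ((hsort x S hx).image var).subset fun v hv => ?_
      have := hv.1
      rw [hx] at this
      obtain ⟨a, ha, rfl⟩ := this
      exact ⟨a, ha, rfl⟩
  have hc : (⋃ c ∈ prims.composers,
      func c.fn '' Set.univ.pi fun _ => Y).Finite :=
    hcomp.biUnion fun c _ => (Set.Finite.pi fun _ => hY).image _
  have hs : (⋃ r ∈ {r | r ∈ prot.rules}, {v | ∃ σ : X → L.Term A,
      (∀ x, Subterm (var (Sum.inr x)) r.sent → σ x ∈ B x) ∧ inst σ r.sent = v}).Finite :=
    prot.rules.finite_toSet.biUnion fun r _ => finite_setOf_inst r.sent fun x _ => hB x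
  refine ((hc.union hsub).union hs).subset ?_
  rintro _ ⟨_, (hr | ⟨c, hc, u, -, rfl⟩ | ⟨d, hd, u, -, rfl⟩) | ⟨σ, hσ, r, hr, rfl⟩, hl, hn, rfl⟩
  · exact absurd hl (hH _ hr)
  · exact Or.inl (Or.inl (Set.mem_biUnion hc ⟨u, fun i _ => hn ⟨rfl, i, rfl⟩, rfl⟩))
  · exact Or.inl (Or.inr (Set.mem_biUnion (hn ⟨rfl, Or.inl rfl⟩) (.arg _ _ _ (.refl _))))
  · refine Or.inr (Set.mem_biUnion hr ⟨σ, fun x hx => ⟨hσ x, fun hnone => ?_⟩, rfl⟩)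
    obtain ⟨u, hu, hxu⟩ := hprot r hr x hnone hx
    exact Set.mem_biUnion (hn ⟨rfl, u, hu, rfl⟩) (inst_subterm_inst σ hxu)

/-- Starting from the initial values of `o`, each step has a finite bound uniform in `R'` and `q`.
Since `N` steps suffice, all the sets are subsets of one finite set. -/
theorem finite_checkedSets (hprot : prot.RangeRestricted)
    {H : Set (CommRule P (L.Term A))} (hH : ∀ r ∈ H, r.learner ≠ o)
    (hsort : ∀ x S, prot.sort x = some S → S.Finite) (hcomp : prims.composers.Finite)
    {k₀ : Set (P × L.Term A)} (hk₀ : {v | (o, v) ∈ k₀}.Finite) (N : ℕ) :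
    {S | ∃ R' ⊆ flowRules H prims prot {σ | prot.IsSession σ},
      S ∈ checkedSets R' o k₀ N}.Finite := by
  have hbound : ∀ n : ℕ, ∃ F : Set (L.Term A), F.Finite ∧
      ∀ R' ⊆ flowRules H prims prot {σ | prot.IsSession σ}, ∀ q ∈ smallStates o k₀ N,
        (gStep R' o q.1)^[n] q.2 ⊆ F := by
    intro n
    induction n with
    | zero => exact ⟨_, hk₀, fun R' _ q hq => subset_of_mem_smallStates hq⟩
    | succ n ih =>
      obtain ⟨F, hF, hn⟩ := ih
      refine ⟨_, hF.union (finite_values_of_flowRules hprot hH hsort hcomp hF),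
        fun R' hR' q hq => ?_⟩
      rw [Function.iterate_succ_apply']
      rintro x (hx | ⟨Z, hZ, r, hr, -, hl, rfl, rfl⟩)
      · exact Or.inl (hn R' hR' q hq hx)
      · exact Or.inr ⟨r, hR' hr.1, hl, hZ.trans (hn R' hR' q hq), rfl⟩
  obtain ⟨F, hF, hn⟩ := hbound N
  refine hF.finite_subsets.subset ?_
  rintro _ ⟨R', hR', q, hq, rfl⟩
  rw [Set.mem_ofPred_eq, gStar_eq_iterate R' hq]
  exact hn R' hR' q hq

/-! ### Attacks -/

theorem isAttack_of_derives {H : Set (CommRule P (L.Term A))} {k₀ : Set (P × L.Term A)}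
    (hhonest : ∀ p, p ≠ o → ∀ v, (p, v) ∈ k₀) {w : ℕ} {τ : Fin w → X → L.Term A}
    (hτ : ∀ i, prot.IsSession (τ i))
    (h : ∃ i, ∀ s ∈ prot.secrets,
      Derives prims prot (Set.range τ) {v | (o, v) ∈ k₀} W (inst (τ i) s)) :
    IsAttack H prims prot (restrictTo k₀ W) τ :=
  ⟨hτ, h.imp fun _ hi s hs => (hi s hs).mem_fStar H hhonest⟩

theorem isAttack_of_gStar {H : Set (CommRule P (L.Term A))} (hH : ∀ r ∈ H, r.learner ≠ o)
    {k₀ k : Set (P × L.Term A)} (hhonest : ∀ p, p ≠ o → ∀ v, (p, v) ∈ k₀) {w : ℕ}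
    {τ : Fin w → X → L.Term A} (hτ : ∀ i, prot.IsSession (τ i)) {Y : Set (L.Term A)}
    (hY : Y ⊆ {v | (o, v) ∈ k₀})
    (h : ∃ i, ∀ s ∈ prot.secrets,
      inst (τ i) s ∈ gStar (flowRules H prims prot (Set.range τ)) o k Y) :
    IsAttack H prims prot k₀ τ := by
  have := isAttack_of_derives (H := H) hhonest hτ
    (h.imp fun _ hi s hs => derives_of_mem_gStar hH hY (hi s hs))
  rwa [show restrictTo k₀ Set.univ = k₀ by simp [restrictTo]] at this

theorem exists_isAttack_of_derives {H : Set (CommRule P (L.Term A))} {k₀ : Set (P × L.Term A)}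
    (hhonest : ∀ p, p ≠ o → ∀ v, (p, v) ∈ k₀) (hT : ∀ σ ∈ T, prot.IsSession σ)
    {σ : X → L.Term A} (hσ : prot.IsSession σ)
    (h : ∀ s ∈ prot.secrets, Derives prims prot T {v | (o, v) ∈ k₀} Set.univ (inst σ s)) :
    ∃ (n : ℕ) (τ : Fin n → X → L.Term A), IsAttack H prims prot k₀ τ := by
  choose F hFT hF hd using fun s hs => (h s hs).exists_finite
  -- The session `σ` is inserted because the derivations of its secrets need not use it, while an
  -- attack must include the session it breaks.
  obtain ⟨n, τ, -, hτ⟩ := ((prot.secrets.finite_toSet.biUnion' hF).insert σ).fin_param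
  have hsub : ∀ s hs, F s hs ⊆ Set.range τ := fun s hs => hτ ▸
    (Set.subset_iUnion₂ (s := F) s hs).trans (Set.subset_insert _ _)
  obtain ⟨i, hi⟩ : σ ∈ Set.range τ := hτ ▸ Set.mem_insert _ _
  refine ⟨n, τ, ?_⟩
  have := isAttack_of_derives (prims := prims) (prot := prot) (H := H) (W := Set.univ) hhonest
    (τ := τ) (fun i => ?_) ⟨i, fun s hs => hi ▸ (hd s hs).mono (hsub s hs) subset_rfl⟩
  · rwa [show restrictTo k₀ Set.univ = k₀ by simp [restrictTo]] at this
  · have : τ i ∈ Set.range τ := ⟨i, rfl⟩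
    rw [hτ] at this
    obtain h | h := this
    · exact h ▸ hσ
    · obtain ⟨s, hs, hmem⟩ := Set.mem_iUnion₂.1 h
      exact hT _ (hFT s hs hmem)

theorem encard_knowledge_restrictTo_le (k : Set (P × L.Term A)) (W : Set (L.Term A)) :
    (Knowledge (restrictTo k W)).encard ≤ W.encard :=
  Set.encard_le_encard fun _ ⟨_, hp⟩ => hp.2

theorem restrictTo_subset (k : Set (P × L.Term A)) (W : Set (L.Term A)) : restrictTo k W ⊆ k :=
  fun _ h => h.1

theorem mem_smallStates_restrictTo (k₀ : Set (P × L.Term A)) {N : ℕ} (hW : W.encard ≤ N) :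
    (restrictTo k₀ W, {v | (o, v) ∈ restrictTo k₀ W}) ∈ smallStates o k₀ N :=
  ⟨by rintro ⟨p, v⟩ ⟨rfl, hv⟩; exact hv, restrictTo_subset _ _,
    (encard_knowledge_restrictTo_le _ _).trans hW⟩

theorem flowRules_mono (H : Set (CommRule P (L.Term A))) (prims : Primitives L A o)
    (prot : Protocol L A X o) {T T' : Set (X → L.Term A)} (h : T ⊆ T') :
    flowRules H prims prot T ⊆ flowRules H prims prot T' :=
  Set.union_subset_union_right _ fun _ ⟨σ, hσ, hr⟩ => ⟨σ, h hσ, hr⟩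

end Protocols

end KnowledgeFlow

/-! ### The main theorem -/

open KnowledgeFlow in
theorem mainTheorem3 {L : FirstOrder.Language} {A X P : Type*} {o : P}
    (prims : Primitives L A o) (prot : Protocol L A X o) (hprot : prot.RangeRestricted)
    (H : Set (CommRule P (L.Term A))) (hH : ∀ r ∈ H, r.learner ≠ o)
    (k₀ : Set (P × L.Term A))
    (hhonest : ∀ p, p ≠ o → ∀ v, (p, v) ∈ k₀)
    (hatomic : ∀ v, (o, v) ∈ k₀ → ∃ a, v = FirstOrder.Language.Term.var a)
    (R : Set (CommRule P (L.Term A)))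
    (hR : R = flowRules H prims prot {σ | prot.IsSession σ})
    (w : ℕ) :
    -- small model
    ((∃ τ : Fin w → X → L.Term A, IsAttack H prims prot k₀ τ) →
      ∃ kσ ⊆ k₀, (Knowledge kσ).encard ≤ (w * prot.size : ℕ) ∧
        ∃ τ : Fin w → X → L.Term A, IsAttack H prims prot kσ τ ∧
          (∀ i, ∀ t ∈ prot.sessionValues, inst (τ i) t ∈ Knowledge kσ) ∧
          IsValidState R k₀ (fStar (flowRules H prims prot (Set.range τ)) kσ)) ∧
    -- checking the small states decides about the attacks with `w` sessions
    ((∃ τ : Fin w → X → L.Term A, IsAttack H prims prot k₀ τ) ↔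
      ∃ τ : Fin w → X → L.Term A, (∀ i, prot.IsSession (τ i)) ∧
        ∃ S ∈ checkedSets (flowRules H prims prot (Set.range τ)) o k₀ (w * prot.size),
          ∃ i, ∀ s ∈ prot.secrets, inst (τ i) s ∈ S) ∧
    -- it is enough to check the restrictions of `k₀` to small sets closed under subterms
    ((∃ τ : Fin w → X → L.Term A, IsAttack H prims prot k₀ τ) ↔
      ∃ W ∈ closedSets L A (w * prot.size), ∃ τ : Fin w → X → L.Term A,
        (∀ i, prot.IsSession (τ i)) ∧ (∀ i, ∀ t ∈ prot.sessionValues, inst (τ i) t ∈ W) ∧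
          ∃ i, ∀ s ∈ prot.secrets,
            inst (τ i) s ∈ gStar (flowRules H prims prot (Set.range τ)) o (restrictTo k₀ W)
              {v | (o, v) ∈ restrictTo k₀ W}) ∧
    -- the check with all rules misses no attack with `w` sessions and reports only attacks
    ((∃ τ : Fin w → X → L.Term A, IsAttack H prims prot k₀ τ) →
      ∃ σ, prot.IsSession σ ∧ ∃ S ∈ checkedSets R o k₀ (w * prot.size),
        ∀ s ∈ prot.secrets, inst σ s ∈ S) ∧
    (∀ σ, prot.IsSession σ → ∀ S ∈ checkedSets R o k₀ (w * prot.size),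
      (∀ s ∈ prot.secrets, inst σ s ∈ S) →
        ∃ (n : ℕ) (τ : Fin n → X → L.Term A), IsAttack H prims prot k₀ τ) ∧
    -- each set is computed in finitely many steps
    (∀ R' ⊆ R, ∀ q ∈ smallStates o k₀ (w * prot.size),
      gStar R' o q.1 q.2 = (gStep R' o q.1)^[w * prot.size] q.2) ∧
    -- there are finitely many sets to be checked
    (Finite A → Finite (Σ n, L.Functions n) → (closedSets L A (w * prot.size)).Finite) ∧
    ({v | (o, v) ∈ k₀}.Finite → (∀ x S, prot.sort x = some S → S.Finite) →
      prims.composers.Finite →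
        {S | ∃ R' ⊆ R, S ∈ checkedSets R' o k₀ (w * prot.size)}.Finite) := by
  subst hR
  have hsessions : ∀ {τ : Fin w → X → L.Term A}, (∀ i, prot.IsSession (τ i)) →
      flowRules H prims prot (Set.range τ) ⊆ flowRules H prims prot {σ | prot.IsSession σ} :=
    fun hτ => flowRules_mono H prims prot (Set.range_subset_iff.2 hτ)
  refine ⟨fun h => ?_, ⟨fun h => ?_, ?_⟩, ⟨fun h => ?_, ?_⟩, fun h => ?_, ?_,
    fun R' _ q hq => gStar_eq_iterate R' hq, fun _ _ => finite_closedSets _,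
    fun hk₀ hsort hcomp => finite_checkedSets hprot hH hsort hcomp hk₀ _⟩
  · obtain ⟨τ, hτ, -, hknown, hder⟩ := exists_local_attack hprot hH hhonest hatomic h
    -- The small state is the part of `k₀` about the session values of a local attack, at most `m`
    -- for each of the `w` sessions.
    refine ⟨restrictTo k₀ (prot.instances (Set.range τ)), restrictTo_subset _ _,
      (encard_knowledge_restrictTo_le _ _).trans (prot.encard_instances_range_le τ), τ,
      isAttack_of_derives hhonest hτ hder, fun i t ht => ?_,
      _, hsessions hτ, _, restrictTo_subset _ _, rfl⟩
    have hmem : inst (τ i) t ∈ prot.instances (Set.range τ) := ⟨_, ⟨i, rfl⟩, t, ht, rfl⟩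
    obtain ⟨p, hp⟩ := hknown _ hmem
    exact ⟨p, hp, hmem⟩
  · obtain ⟨τ, hτ, -, -, i, hi⟩ := exists_local_attack hprot hH hhonest hatomic h
    exact ⟨τ, hτ, _, ⟨_, mem_smallStates_restrictTo k₀ (prot.encard_instances_range_le τ), rfl⟩,
      i, fun s hs => (hi s hs).mem_gStar H hhonest⟩
  · rintro ⟨τ, hτ, _, ⟨q, hq, rfl⟩, hsecrets⟩
    exact ⟨τ, isAttack_of_gStar hH hhonest hτ (subset_of_mem_smallStates hq) hsecrets⟩
  · obtain ⟨τ, hτ, hclosed, -, i, hi⟩ := exists_local_attack hprot hH hhonest hatomic h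
    exact ⟨_, ⟨prot.encard_instances_range_le τ, hclosed⟩, τ, hτ,
      fun i t ht => ⟨_, ⟨i, rfl⟩, t, ht, rfl⟩, i, fun s hs => (hi s hs).mem_gStar H hhonest⟩
  · rintro ⟨W, -, τ, hτ, -, hsecrets⟩
    exact ⟨τ, isAttack_of_gStar hH hhonest hτ (fun _ hv => hv.1) hsecrets⟩
  · obtain ⟨τ, hτ, -, -, i, hi⟩ := exists_local_attack hprot hH hhonest hatomic h
    exact ⟨τ i, hτ i, _,
      ⟨_, mem_smallStates_restrictTo k₀ (prot.encard_instances_range_le τ), rfl⟩,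
      fun s hs => gStar_mono (hsessions hτ) _ _ _ ((hi s hs).mem_gStar H hhonest)⟩
  · rintro σ hσ _ ⟨q, hq, rfl⟩ hsecrets
    exact exists_isAttack_of_derives hhonest (fun _ h => h) hσ fun s hs =>
      derives_of_mem_gStar hH (subset_of_mem_smallStates hq) (hsecrets s hs)
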